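/- Let $(z_k)_{k\ge1}$ be an infinite sequence in the open unit disc $\mathbb D$ (repetitions allowed) with $\sum_k(1-|z_k|)<\infty$, and let $$B(z)=\prod_{k}\frac{\bar z_k(z_k-z)}{|z_k|(1-\bar z_kz)}$$ be the Blaschke product with these zeros (a factor with $z_k=0$ being read as $z$). For $p\ge1$ put $$m_p(r)=\Bigl(\frac1{2\pi}\int_0^{2\pi}\bigl|\log|B(re^{i\theta})|\bigr|^p\,d\theta\Bigr)^{1/p},\qquad \rho_p[B]=\limsup_{r\uparrow1}\frac{\log m_p(r)}{-\log(1-r)},\qquad \rho_\infty[B]=\lim_{p\to\infty}\rho_p[B].$$ For $\varphi\in\mathbb R$ and $0<\delta<1$ let $$S(\varphi,\delta)=\{\rho e^{i\theta}:\ 0\le\rho\le1,\ \rho\ge1-\delta,\ -\pi\delta<\theta-\varphi\le\pi\delta\},$$ and for $0\le r<1$ let $\lambda(\varphi,r)=\sum_{k:\,z_k\in S(\varphi,(1-r)/2)}(1-|z_k|)$. Set $$t[B]=\sup\Bigl\{\gamma\ge0:\ \sup_{\varphi\in\mathbb R}\lambda(\varphi,r)=O\bigl((1-r)^\gamma\bigr)\text{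 as }r\uparrow1\Bigr\}.$$ Then the limit defining $\rho_\infty[B]$ exists and $\rho_\infty[B]=1-t[B]$. -/

import Mathlib

open Filter Topology Asymptotics MeasureTheory
open scoped ENNReal ComplexConjugate

noncomputable section

/-- The elementary Blaschke factor with zero `a`; for `a = 0` it is `z`, as usual. -/
def blaschkeFactor (a z : ℂ) : ℂ :=
  if a = 0 then z else conj a * (a - z) / ((‖a‖ : ℂ) * (1 - conj a * z))

/-- `Z` is an infinite sequence in the open unit disc (listed with multiplicities)
satisfying the Blaschke condition. -/
structure IsBlaschkeSequence (Z : ℕ → ℂ) : Prop where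
  norm_lt_one : ∀ n, ‖Z n‖ < 1
  summable : Summable fun n => 1 - ‖Z n‖

/-- The Blaschke product with zero sequence `Z`. -/
def blaschkeProduct (Z : ℕ → ℂ) (z : ℂ) : ℂ := ∏' n, blaschkeFactor (Z n) z

/-- The Carleson square `S(φ, δ)`. -/
def carlesonSquare (φ δ : ℝ) : Set ℂ :=
  {w | ∃ ρ θ : ℝ, 0 ≤ ρ ∧ ρ ≤ 1 ∧ 1 - δ ≤ ρ ∧ -(Real.pi * δ) < θ - φ ∧ θ - φ ≤ Real.pi * δ ∧
    w = (ρ : ℂ) * Complex.exp ((θ : ℂ) * Complex.I)}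

/-- `λ(φ, r)`: the sum of `1 - |z_k|` over the indices `k` with `z_k ∈ S(φ, (1 - r) / 2)`. -/
def carlesonMass (Z : ℕ → ℂ) (φ r : ℝ) : ℝ :=
  ∑' k, (carlesonSquare φ ((1 - r) / 2)).indicator (fun w => 1 - ‖w‖) (Z k)

/-- `t[B]` for the Blaschke product `B` with zero sequence `Z`: the supremum, in the extended
reals, of all real `γ ≥ 0` with `sup_φ λ(φ, r) = O((1 - r) ^ γ)` as `r ↑ 1`. -/
def carlesonExponent (Z : ℕ → ℂ) : EReal :=
  sSup ((fun γ : ℝ => (γ : EReal)) '' {γ : ℝ | 0 ≤ γ ∧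
    (fun r : ℝ => ⨆ φ : ℝ, carlesonMass Z φ r) =O[𝓝[<] 1] fun r : ℝ => (1 - r) ^ γ})

/-- The `p`-th integral mean `m_p(r, f)` of `log |f|` over the circle `|z| = r`. -/
def logMean (p : ℝ) (f : ℂ → ℂ) (r : ℝ) : ℝ≥0∞ :=
  ((ENNReal.ofReal (2 * Real.pi))⁻¹ * ∫⁻ θ in Set.Ioc (0 : ℝ) (2 * Real.pi),
    ENNReal.ofReal |Real.log ‖f ((r : ℂ) * Complex.exp ((θ : ℂ) * Complex.I))‖| ^ p) ^ (1 / p)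

/-- The order `ρ_p[f] = limsup_{r ↑ 1} log m_p(r, f) / (-log (1 - r))`. -/
def rhoOrder (p : ℝ) (f : ℂ → ℂ) : EReal :=
  limsup (fun r : ℝ => ENNReal.log (logMean p f r) / ((-Real.log (1 - r) : ℝ) : EReal)) (𝓝[<] 1)

/-- The order `ρ_∞[f] = lim_{p → ∞} ρ_p[f]`. -/
def rhoInfOrder (f : ℂ → ℂ) : EReal := limUnder atTop fun p : ℝ => rhoOrder p f

end

/-! Write w_a(z) = 1 - |b_a(z)|² for the Blaschke factor b_a. On |z| = r this is (1 - r²)(1 -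
|a|²)/|1 - āz|², and -log|B| is the sum of the terms -log|b_a|, each of which is at least w_a/2.

Lower bound: on an arc of length 1 - r about φ, every zero in S(φ, (1-r)/2) has |1 - āz| ≤ 4(1-r),
so |log|B|| is at least λ(φ,r)/(32(1-r)) there. Integrating over that arc alone costs only a factor
(1-r)^(1/p), whence ρ_p ≥ 1 - 1/p - t (`le_logMean`, `isBigO_carlesonMass_of_rhoOrder_lt`).

Upper bound: -log|b_a| ≤ 2p w_a |b_a|^(-1/(2p)). Hölder's inequality with weights w_a bounds the
p-th power of the sum by (∑ w_a)^(p-1) ∑ w_a |b_a|^(-1/2). A dyadic decomposition gives ∑ w_a =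
O((1-r)^(γ-1)) pointwise for every admissible γ (`tsum_blaschkeWeight_le`), while the integral of
w_a |b_a|^(-1/2) over the circle is O(1 - |a|) uniformly in r
(`lintegral_blaschkeWeight_mul_rpow_le`), which is summable. Hence ρ_p ≤ (1-γ)(1-1/p) ≤ 1 - γ.

Letting γ increase to t and then p → ∞ squeezes ρ_p to 1 - t. -/

/-! ### Estimates for a single Blaschke factor. -/

section BlaschkeFactor

variable {a z : ℂ}

theorem norm_conj_mul_lt_one (ha : ‖a‖ < 1) (hz : ‖z‖ < 1) : ‖conj a * z‖ < 1 := by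
  rw [norm_mul, RCLike.norm_conj]
  nlinarith [norm_nonneg a, norm_nonneg z]

theorem one_sub_conj_mul_ne_zero (ha : ‖a‖ < 1) (hz : ‖z‖ < 1) : 1 - conj a * z ≠ 0 := by
  intro h
  have h1 := norm_conj_mul_lt_one ha hz
  rw [← sub_eq_zero.1 h, norm_one] at h1
  exact lt_irrefl _ h1

theorem one_sub_norm_le_norm_one_sub_conj_mul (ha : ‖a‖ ≤ 1) :
    1 - ‖z‖ ≤ ‖1 - conj a * z‖ := by
  have h1 : ‖(1 : ℂ)‖ - ‖conj a * z‖ ≤ ‖1 - conj a * z‖ := norm_sub_norm_le _ _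
  rw [norm_one, norm_mul, RCLike.norm_conj] at h1
  nlinarith [norm_nonneg a, norm_nonneg z]

theorem one_sub_norm_le_norm_one_sub_conj_mul' (hz : ‖z‖ ≤ 1) :
    1 - ‖a‖ ≤ ‖1 - conj a * z‖ := by
  have h1 : ‖(1 : ℂ)‖ - ‖conj a * z‖ ≤ ‖1 - conj a * z‖ := norm_sub_norm_le _ _
  rw [norm_one, norm_mul, RCLike.norm_conj] at h1
  nlinarith [norm_nonneg a, norm_nonneg z]

theorem norm_blaschkeFactor (a z : ℂ) :
    ‖blaschkeFactor a z‖ = ‖a - z‖ / ‖1 - conj a * z‖ := by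
  unfold blaschkeFactor
  split_ifs with h
  · simp [h]
  · have : ‖a‖ ≠ 0 := norm_ne_zero_iff.2 h
    rw [norm_div, norm_mul, norm_mul, RCLike.norm_conj, Complex.norm_real, norm_norm,
      mul_div_mul_left _ _ this]

theorem blaschkeFactor_ne_zero (ha : ‖a‖ < 1) (hz : ‖z‖ < 1) (h : z ≠ a) :
    blaschkeFactor a z ≠ 0 := by
  rw [← norm_pos_iff, norm_blaschkeFactor]
  exact div_pos (norm_pos_iff.2 (sub_ne_zero.2 h.symm))
    (norm_pos_iff.2 (one_sub_conj_mul_ne_zero ha hz))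

/-- The quantity `1 - |b_a(z)|²`, where `b_a` is the Blaschke factor with zero `a`. -/
noncomputable def blaschkeWeight (a z : ℂ) : ℝ :=
  (1 - ‖z‖ ^ 2) * (1 - ‖a‖ ^ 2) / ‖1 - conj a * z‖ ^ 2

/-- This is the identity |1 - āz|² - |a - z|² = (1 - |a|²)(1 - |z|²), divided by |1 - āz|². -/
theorem norm_blaschkeFactor_sq (ha : ‖a‖ < 1) (hz : ‖z‖ < 1) :
    ‖blaschkeFactor a z‖ ^ 2 = 1 - blaschkeWeight a z := by
  have h := norm_ne_zero_iff.2 (one_sub_conj_mul_ne_zero ha hz)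
  have key : ‖a - z‖ ^ 2 + (1 - ‖z‖ ^ 2) * (1 - ‖a‖ ^ 2) = ‖1 - conj a * z‖ ^ 2 := by
    simp only [← Complex.normSq_eq_norm_sq, Complex.normSq_apply, Complex.sub_re, Complex.sub_im,
      Complex.mul_re, Complex.mul_im, Complex.conj_re, Complex.conj_im, Complex.one_re,
      Complex.one_im]
    ring
  rw [norm_blaschkeFactor, blaschkeWeight, div_pow, eq_sub_iff_add_eq, ← add_div, key,
    div_self (pow_ne_zero 2 h)]

theorem blaschkeWeight_pos (ha : ‖a‖ < 1) (hz : ‖z‖ < 1) : 0 < blaschkeWeight a z := by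
  have h := norm_pos_iff.2 (one_sub_conj_mul_ne_zero ha hz)
  have h1 : 0 < 1 - ‖z‖ ^ 2 := by nlinarith [norm_nonneg z]
  have h2 : 0 < 1 - ‖a‖ ^ 2 := by nlinarith [norm_nonneg a]
  unfold blaschkeWeight
  positivity

theorem norm_blaschkeFactor_lt_one (ha : ‖a‖ < 1) (hz : ‖z‖ < 1) : ‖blaschkeFactor a z‖ < 1 := by
  have h := norm_blaschkeFactor_sq ha hz
  have h1 := blaschkeWeight_pos ha hz
  nlinarith [norm_nonneg (blaschkeFactor a z)]

/-- Linear in 1 - |a|, so the Blaschke condition gives absolute convergence of the product. -/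
theorem norm_blaschkeFactor_sub_one_le (ha : ‖a‖ < 1) (hz : ‖z‖ < 1) :
    ‖blaschkeFactor a z - 1‖ ≤ (1 - ‖a‖) * (2 / (1 - ‖z‖)) := by
  have hz' : 0 < 1 - ‖z‖ := by linarith
  by_cases h : a = 0
  · have h1 : ‖z - 1‖ ≤ ‖z‖ + ‖(1 : ℂ)‖ := norm_sub_le _ _
    rw [norm_one] at h1
    simp only [blaschkeFactor, h, if_true, norm_zero, sub_zero, one_mul]
    rw [le_div_iff₀ hz']
    nlinarith [norm_nonneg z, norm_nonneg (z - 1)]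
  · have hD := one_sub_conj_mul_ne_zero ha hz
    have hn : (‖a‖ : ℂ) ≠ 0 := Complex.ofReal_ne_zero.2 (norm_ne_zero_iff.2 h)
    have hna : 0 < ‖a‖ := norm_pos_iff.2 h
    have e : blaschkeFactor a z - 1 =
        ((‖a‖ : ℂ) - 1) * ((‖a‖ : ℂ) + conj a * z) / ((‖a‖ : ℂ) * (1 - conj a * z)) := by
      have := Complex.conj_mul' a
      simp only [blaschkeFactor, h, if_false]
      rw [div_sub_one (mul_ne_zero hn hD)]
      congr 1
      linear_combination this
    have e1 : ‖(‖a‖ : ℂ) - 1‖ = 1 - ‖a‖ := by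
      rw [← Complex.ofReal_one, ← Complex.ofReal_sub, Complex.norm_real, Real.norm_eq_abs,
        abs_sub_comm, abs_of_pos (by linarith)]
    have e2 : ‖(‖a‖ : ℂ) + conj a * z‖ ≤ 2 * ‖a‖ := by
      refine (norm_add_le _ _).trans ?_
      rw [norm_mul, RCLike.norm_conj, Complex.norm_real, norm_norm]
      nlinarith [norm_nonneg z]
    rw [e, norm_div, norm_mul, norm_mul, e1, Complex.norm_real, norm_norm, mul_div_assoc]
    have h3 := one_sub_norm_le_norm_one_sub_conj_mul (z := z) ha.le
    refine mul_le_mul_of_nonneg_left ?_ (by linarith)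
    calc _ ≤ 2 * ‖a‖ / (‖a‖ * (1 - ‖z‖)) := by gcongr
      _ = _ := by field_simp

/-- Lower bound for `-log |b_a(z)|` by the weight. -/
theorem blaschkeWeight_le_neg_log (ha : ‖a‖ < 1) (hz : ‖z‖ < 1) (h : z ≠ a) :
    blaschkeWeight a z / 2 ≤ -Real.log ‖blaschkeFactor a z‖ := by
  have h0 := norm_pos_iff.2 (blaschkeFactor_ne_zero ha hz h)
  have h1 := Real.log_le_sub_one_of_pos (pow_pos h0 2)
  rw [Real.log_pow, norm_blaschkeFactor_sq ha hz] at h1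
  push_cast at h1
  linarith

/-- Upper bound for `-log |b_a(z)|` by the weight times a negative power of `|b_a(z)|`. -/
theorem neg_log_le_blaschkeWeight (ha : ‖a‖ < 1) (hz : ‖z‖ < 1) (h : z ≠ a) {p : ℝ} (hp : 1 ≤ p) :
    -Real.log ‖blaschkeFactor a z‖ ≤
      2 * p * (blaschkeWeight a z * ‖blaschkeFactor a z‖ ^ (-(1 / (2 * p)))) := by
  have h0 := norm_pos_iff.2 (blaschkeFactor_ne_zero ha hz h)
  have h1 := norm_blaschkeFactor_lt_one ha hz
  set x := ‖blaschkeFactor a z‖ with hx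
  have hw : blaschkeWeight a z = 1 - x ^ 2 := by
    have := norm_blaschkeFactor_sq ha hz
    linarith
  have hε : 0 < 1 / (2 * p) := by positivity
  set ε := 1 / (2 * p) with hεd
  have hε1 : ε ≤ 1 := by
    rw [hεd, div_le_one (by positivity)]
    linarith
  have e1 : 2 * p = 1 / ε := by rw [hεd, one_div_one_div]
  have hy : 0 < x ^ (-ε) := Real.rpow_pos_of_pos h0 _
  -- ε log(1/x) ≤ x^(-ε) - 1 = x^(-ε)(1 - x^ε), and x² ≤ x^ε. The choice ε = 1/(2p) turns x^(-ε)
  -- into the integrable singularity x^(-1/2) after raising to the power p.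
  have h2 := Real.log_le_sub_one_of_pos hy
  rw [Real.log_rpow h0] at h2
  have h3 : x ^ (2 : ℕ) ≤ x ^ ε := by
    rw [← Real.rpow_natCast]
    exact Real.rpow_le_rpow_of_exponent_ge h0 h1.le (by push_cast; linarith)
  have h4 : x ^ ε * x ^ (-ε) = 1 := by
    rw [← Real.rpow_add h0, add_neg_cancel, Real.rpow_zero]
  rw [hw, e1, one_div, inv_mul_eq_div, le_div_iff₀ hε]
  nlinarith

end BlaschkeFactor

/-! ### The logarithm of the product as a sum. -/

section Product

variable {Z : ℕ → ℂ}

theorem IsBlaschkeSequence.summable_norm_blaschkeFactor_sub_one (hZ : IsBlaschkeSequence Z) {z : ℂ}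
    (hz : ‖z‖ < 1) : Summable fun n => ‖blaschkeFactor (Z n) z - 1‖ :=
  Summable.of_nonneg_of_le (fun _ => norm_nonneg _)
    (fun n => norm_blaschkeFactor_sub_one_le (hZ.norm_lt_one n) hz) (hZ.summable.mul_right _)

/-- Away from its zeros, `-log |B|` is the sum of the corresponding terms of the factors. -/
theorem IsBlaschkeSequence.hasSum_neg_log (hZ : IsBlaschkeSequence Z) {z : ℂ} (hz : ‖z‖ < 1)
    (h : ∀ n, z ≠ Z n) :
    HasSum (fun n => -Real.log ‖blaschkeFactor (Z n) z‖) |Real.log ‖blaschkeProduct Z z‖| := by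
  have h0 : ∀ n, 0 < ‖blaschkeFactor (Z n) z‖ := fun n =>
    norm_pos_iff.2 (blaschkeFactor_ne_zero (hZ.norm_lt_one n) hz (h n))
  have hs := hZ.summable_norm_blaschkeFactor_sub_one hz
  have hl := hs.summable_log_norm_one_add
  have hm := multipliable_one_add_of_summable hs
  simp only [add_sub_cancel] at hl hm
  have e : Real.log ‖blaschkeProduct Z z‖ = ∑' n, Real.log ‖blaschkeFactor (Z n) z‖ := by
    rw [blaschkeProduct, hm.norm_tprod, ← Real.rexp_tsum_eq_tprod h0 hl, Real.log_exp]
  rw [abs_of_nonpos, e]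
  · exact hl.hasSum.neg
  · rw [e]
    exact tsum_nonpos fun n => Real.log_nonpos (norm_nonneg _)
      (norm_blaschkeFactor_lt_one (hZ.norm_lt_one n) hz).le

end Product

/-! ### Geometry and measure on circles. -/

section Circle

theorem norm_circle {r : ℝ} (hr : 0 ≤ r) (θ : ℝ) :
    ‖(r : ℂ) * Complex.exp ((θ : ℂ) * Complex.I)‖ = r := by
  rw [norm_mul, Complex.norm_exp_ofReal_mul_I, mul_one, Complex.norm_real, Real.norm_eq_abs,
    abs_of_nonneg hr]

theorem periodic_circle (r : ℝ) :
    Function.Periodic (fun θ : ℝ => (r : ℂ) * Complex.exp ((θ : ℂ) * Complex.I))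
      (2 * Real.pi) := by
  intro θ
  have : ((θ + 2 * Real.pi : ℝ) : ℂ) * Complex.I =
      (θ : ℂ) * Complex.I + 2 * Real.pi * Complex.I := by
    push_cast; ring
  simp only [this, Complex.exp_periodic _]

theorem setLIntegral_Ioc_of_periodic {F : ℝ → ℝ≥0∞} (hF : Function.Periodic F (2 * Real.pi))
    (φ : ℝ) :
    ∫⁻ θ in Set.Ioc 0 (2 * Real.pi), F θ = ∫⁻ θ in Set.Ioc (φ - Real.pi) (φ + Real.pi), F θ := by
  have h1 := isAddFundamentalDomain_Ioc Real.two_pi_pos 0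
  have h2 := isAddFundamentalDomain_Ioc Real.two_pi_pos (φ - Real.pi)
  rw [zero_add] at h1
  rw [show φ - Real.pi + 2 * Real.pi = φ + Real.pi by ring] at h2
  exact h1.setLIntegral_eq h2 F hF.map_vadd_zmultiples

theorem exists_polar_near (a : ℂ) (φ : ℝ) :
    ∃ α : ℝ, a = (‖a‖ : ℂ) * Complex.exp ((α : ℂ) * Complex.I) ∧ -Real.pi < α - φ ∧
      α - φ ≤ Real.pi := by
  refine ⟨φ + (a * Complex.exp (-(φ * Complex.I))).arg, ?_, ?_, ?_⟩
  · have h := Complex.norm_mul_exp_arg_mul_I (a * Complex.exp (-(φ * Complex.I)))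
    have h1 : ‖a * Complex.exp (-(φ * Complex.I))‖ = ‖a‖ := by
      rw [norm_mul, ← neg_mul, ← Complex.ofReal_neg, Complex.norm_exp_ofReal_mul_I, mul_one]
    rw [h1] at h
    push_cast
    rw [add_mul, Complex.exp_add, mul_left_comm, h, mul_left_comm, ← Complex.exp_add,
      add_neg_cancel, Complex.exp_zero, mul_one]
  · rw [add_sub_cancel_left]
    exact Complex.neg_pi_lt_arg _
  · rw [add_sub_cancel_left]
    exact Complex.arg_le_pi _

theorem two_div_pi_mul_abs_le_norm_exp_sub_one {t : ℝ} (ht : |t| ≤ Real.pi) :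
    2 / Real.pi * |t| ≤ ‖Complex.exp ((t : ℂ) * Complex.I) - 1‖ := by
  rw [mul_comm (t : ℂ), Complex.norm_exp_I_mul_ofReal_sub_one, norm_mul, Real.norm_eq_abs,
    Real.norm_eq_abs, abs_two]
  have h := Real.mul_abs_le_abs_sin (x := t / 2) (by rw [abs_div, abs_two]; linarith)
  rw [abs_div, abs_two] at h
  linarith

/-- A point `s e^{it}` is at distance at least `s |t| / π` from the positive half-line. -/
theorem mul_abs_le_norm_sub {s u t : ℝ} (hs : 0 ≤ s) (hu : 0 ≤ u) (ht : |t| ≤ Real.pi) :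
    s * (|t| / Real.pi) ≤ ‖(u : ℂ) - s * Complex.exp ((t : ℂ) * Complex.I)‖ := by
  have h1 := two_div_pi_mul_abs_le_norm_exp_sub_one ht
  set e := Complex.exp ((t : ℂ) * Complex.I) with he
  have hn : ‖e‖ = 1 := Complex.norm_exp_ofReal_mul_I t
  have h2 : ‖(s : ℂ) * e - s‖ ≤ ‖(u : ℂ) - s * e‖ + ‖(u : ℂ) - s‖ := by
    rw [norm_sub_rev (u : ℂ) (s * e)]
    exact norm_sub_le_norm_sub_add_norm_sub _ _ _
  -- |u - s| is the difference of the moduli of u and s e^{it}, so replacing u by s at most doubles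
  -- the distance to s e^{it}.
  have h4 : ‖(u : ℂ) - s‖ ≤ ‖(u : ℂ) - s * e‖ := by
    have := abs_norm_sub_norm_le (u : ℂ) (s * e)
    rwa [norm_mul, hn, mul_one, Complex.norm_real, Complex.norm_real, Real.norm_eq_abs,
      Real.norm_eq_abs, abs_of_nonneg hs, abs_of_nonneg hu, ← Real.norm_eq_abs,
      ← Complex.norm_real, Complex.ofReal_sub] at this
  have h5 : ‖(s : ℂ) * e - s‖ = s * ‖e - 1‖ := by
    rw [← mul_sub_one, norm_mul, Complex.norm_real, Real.norm_eq_abs, abs_of_nonneg hs]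
  rw [h5] at h2
  have h6 := mul_le_mul_of_nonneg_left h1 hs
  have h7 : s * (2 / Real.pi * |t|) = 2 * (s * (|t| / Real.pi)) := by ring
  linarith

/-- A rotation by -t moves the exponential from s to 1, reducing to `mul_abs_le_norm_sub` with unit
modulus. -/
theorem abs_div_pi_le_norm_one_sub {s t : ℝ} (hs : 0 ≤ s) (ht : |t| ≤ Real.pi) :
    |t| / Real.pi ≤ ‖1 - (s : ℂ) * Complex.exp ((t : ℂ) * Complex.I)‖ := by
  have h := mul_abs_le_norm_sub zero_le_one hs (t := -t) (by rwa [abs_neg])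
  have e : (s : ℂ) - (1 : ℝ) * Complex.exp (((-t : ℝ) : ℂ) * Complex.I) =
      -(Complex.exp (((-t : ℝ) : ℂ) * Complex.I) *
        (1 - (s : ℂ) * Complex.exp ((t : ℂ) * Complex.I))) := by
    have : Complex.exp (((-t : ℝ) : ℂ) * Complex.I) * Complex.exp ((t : ℂ) * Complex.I) = 1 := by
      rw [← Complex.exp_add, ← add_mul, ← Complex.ofReal_add, neg_add_cancel, Complex.ofReal_zero,
        zero_mul, Complex.exp_zero]
    rw [Complex.ofReal_one]
    linear_combination -(s : ℂ) * this
  rwa [e, norm_neg, norm_mul, Complex.norm_exp_ofReal_mul_I, one_mul, one_mul, abs_neg] at h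

theorem conj_polar_mul_polar (ρ α r θ : ℝ) :
    conj ((ρ : ℂ) * Complex.exp ((α : ℂ) * Complex.I)) *
        ((r : ℂ) * Complex.exp ((θ : ℂ) * Complex.I)) =
      ((ρ * r : ℝ) : ℂ) * Complex.exp (((θ - α : ℝ) : ℂ) * Complex.I) := by
  rw [map_mul, Complex.conj_ofReal, ← Complex.exp_conj, map_mul, Complex.conj_ofReal,
    Complex.conj_I, mul_mul_mul_comm, ← Complex.exp_add]
  push_cast
  ring_nf

theorem countable_circle_eq {r : ℝ} (hr : r ≠ 0) (a : ℂ) :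
    {θ : ℝ | (r : ℂ) * Complex.exp ((θ : ℂ) * Complex.I) = a}.Countable := by
  rcases Set.eq_empty_or_nonempty {θ : ℝ | (r : ℂ) * Complex.exp ((θ : ℂ) * Complex.I) = a}
    with h | ⟨θ₀, h0⟩
  · rw [h]; exact Set.countable_empty
  · refine (Set.countable_range fun n : ℤ => θ₀ + n * (2 * Real.pi)).mono fun θ hθ => ?_
    have h1 := mul_left_cancel₀ (Complex.ofReal_ne_zero.2 hr)
      ((Set.mem_ofPred.1 hθ).trans (Set.mem_ofPred.1 h0).symm)
    obtain ⟨n, hn⟩ := Complex.exp_eq_exp_iff_exists_int.1 h1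
    refine ⟨n, ?_⟩
    have h2 : ((θ : ℂ) - (θ₀ + n * (2 * Real.pi))) * Complex.I = 0 := by
      rw [sub_mul, hn]; ring
    have h3 := (mul_eq_zero.1 h2).resolve_right Complex.I_ne_zero
    exact_mod_cast (sub_eq_zero.1 h3).symm

theorem ae_circle_ne {r : ℝ} (hr : r ≠ 0) (Z : ℕ → ℂ) :
    ∀ᵐ θ : ℝ, ∀ n, (r : ℂ) * Complex.exp ((θ : ℂ) * Complex.I) ≠ Z n :=
  ae_all_iff.2 fun n => by
    have := (countable_circle_eq hr (Z n)).measure_zero volume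
    rw [ae_iff]
    simpa only [ne_eq, not_not] using this

end Circle

/-! ### Carleson masses and the dyadic bound for the sum of weights. -/

section CarlesonMass

variable {Z : ℕ → ℂ}

theorem IsBlaschkeSequence.indicator_nonneg (hZ : IsBlaschkeSequence Z) (S : Set ℂ) (k : ℕ) :
    0 ≤ S.indicator (fun w => 1 - ‖w‖) (Z k) :=
  Set.indicator_apply_nonneg fun _ => sub_nonneg.2 (hZ.norm_lt_one k).le

theorem IsBlaschkeSequence.indicator_le (hZ : IsBlaschkeSequence Z) (S : Set ℂ) (k : ℕ) :
    S.indicator (fun w => 1 - ‖w‖) (Z k) ≤ 1 - ‖Z k‖ :=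
  Set.indicator_apply_le' (fun _ => le_rfl) fun _ => sub_nonneg.2 (hZ.norm_lt_one k).le

theorem IsBlaschkeSequence.summable_indicator (hZ : IsBlaschkeSequence Z) (S : Set ℂ) :
    Summable fun k => S.indicator (fun w => 1 - ‖w‖) (Z k) :=
  Summable.of_nonneg_of_le (hZ.indicator_nonneg S) (hZ.indicator_le S) hZ.summable

theorem IsBlaschkeSequence.carlesonMass_nonneg (hZ : IsBlaschkeSequence Z) (φ r : ℝ) :
    0 ≤ carlesonMass Z φ r :=
  tsum_nonneg (hZ.indicator_nonneg _)

theorem IsBlaschkeSequence.carlesonMass_le (hZ : IsBlaschkeSequence Z) (φ r : ℝ) :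
    carlesonMass Z φ r ≤ ∑' k, (1 - ‖Z k‖) :=
  (hZ.summable_indicator _).tsum_le_tsum (hZ.indicator_le _) hZ.summable

theorem IsBlaschkeSequence.carlesonMass_le_iSup (hZ : IsBlaschkeSequence Z) (φ r : ℝ) :
    carlesonMass Z φ r ≤ ⨆ φ : ℝ, carlesonMass Z φ r :=
  le_ciSup (f := fun φ => carlesonMass Z φ r)
    ⟨_, Set.forall_mem_range.2 fun φ => hZ.carlesonMass_le φ r⟩ φ

theorem IsBlaschkeSequence.iSup_carlesonMass_nonneg (hZ : IsBlaschkeSequence Z) (r : ℝ) :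
    0 ≤ ⨆ φ : ℝ, carlesonMass Z φ r :=
  (hZ.carlesonMass_nonneg 0 r).trans (hZ.carlesonMass_le_iSup 0 r)

theorem carlesonMass_one_sub_two_mul (Z : ℕ → ℂ) (φ δ : ℝ) :
    carlesonMass Z φ (1 - 2 * δ) =
      ∑' k, (carlesonSquare φ δ).indicator (fun w => 1 - ‖w‖) (Z k) := by
  rw [carlesonMass, show (1 - (1 - 2 * δ)) / 2 = δ by ring]

/-- A power bound for the Carleson masses near the boundary extends to all scales. -/
theorem IsBlaschkeSequence.exists_carlesonMass_le (hZ : IsBlaschkeSequence Z) {γ : ℝ} (hγ : 0 ≤ γ)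
    (h : (fun r : ℝ => ⨆ φ : ℝ, carlesonMass Z φ r) =O[𝓝[<] 1] fun r : ℝ => (1 - r) ^ γ) :
    ∃ C > 0, ∀ δ > 0, ∀ φ, carlesonMass Z φ (1 - 2 * δ) ≤ C * δ ^ γ := by
  obtain ⟨c, hc, hb⟩ := h.exists_pos
  obtain ⟨l, hl, hsub⟩ := (mem_nhdsLT_iff_exists_Ioo_subset (a := (1 : ℝ))).1 hb.bound
  have hl : l < 1 := hl
  set T := ∑' k, (1 - ‖Z k‖) with hT
  have hT0 : 0 ≤ T := tsum_nonneg fun k => sub_nonneg.2 (hZ.norm_lt_one k).le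
  set d := (1 - l) / 2 with hd
  have hd0 : 0 < d := by rw [hd]; linarith
  refine ⟨c * 2 ^ γ + T / d ^ γ, by positivity, fun δ hδ φ => ?_⟩
  have hdγ : 0 < d ^ γ := Real.rpow_pos_of_pos hd0 _
  rcases lt_or_ge δ d with h1 | h1
  · have h2 : 1 - 2 * δ ∈ Set.Ioo l 1 := ⟨by rw [hd] at h1; linarith, by linarith⟩
    have h3 := hsub h2
    simp only [Set.mem_ofPred] at h3
    rw [Real.norm_of_nonneg (hZ.iSup_carlesonMass_nonneg _), show 1 - (1 - 2 * δ) = 2 * δ by ring,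
      Real.norm_of_nonneg (by positivity), Real.mul_rpow two_pos.le hδ.le] at h3
    have h4 := hZ.carlesonMass_le_iSup φ (1 - 2 * δ)
    have h5 : 0 ≤ T / d ^ γ * δ ^ γ := by positivity
    linarith
  -- At large scales the total mass T is a sufficient bound. The dyadic squares below may exceed the
  -- disc, so all scales are needed.
  · have h2 : d ^ γ ≤ δ ^ γ := Real.rpow_le_rpow hd0.le h1 hγ
    have h3 : T ≤ T / d ^ γ * δ ^ γ := by
      rw [div_mul_eq_mul_div, le_div_iff₀ hdγ]
      exact mul_le_mul_of_nonneg_left h2 hT0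
    have h4 := hZ.carlesonMass_le φ (1 - 2 * δ)
    have h5 : 0 ≤ c * 2 ^ γ * δ ^ γ := by positivity
    linarith

/-- |1 - āz| dominates both 1 - |a| and |θ - arg a|/π; the angular half-width πs of the square
absorbs the factor π. -/
theorem mem_carlesonSquare_of_norm_one_sub_lt {a : ℂ} {r θ s : ℝ} (ha : ‖a‖ < 1) (hr : 0 ≤ r)
    (hr1 : r ≤ 1) (h : ‖1 - conj a * ((r : ℂ) * Complex.exp ((θ : ℂ) * Complex.I))‖ < s) :
    a ∈ carlesonSquare θ s := by
  obtain ⟨α, e, h1, h2⟩ := exists_polar_near a θ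
  have h3 := one_sub_norm_le_norm_one_sub_conj_mul' (a := a)
    (z := (r : ℂ) * Complex.exp ((θ : ℂ) * Complex.I)) (by rwa [norm_circle hr])
  have h4 : |θ - α| / Real.pi ≤
      ‖1 - conj a * ((r : ℂ) * Complex.exp ((θ : ℂ) * Complex.I))‖ := by
    rw [e, conj_polar_mul_polar]
    exact abs_div_pi_le_norm_one_sub (mul_nonneg (norm_nonneg a) hr)
      (abs_le.2 ⟨by linarith, by linarith⟩)
  have h5 : |θ - α| < Real.pi * s := by
    rw [← div_lt_iff₀' Real.pi_pos]
    exact h4.trans_lt h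
  have h6 := abs_lt.1 h5
  exact ⟨‖a‖, α, norm_nonneg a, ha.le, by linarith, by linarith, by linarith, e⟩

/-- The weights of the zeros at a point of the circle `|z| = r`, decomposed dyadically into
Carleson squares. -/
theorem IsBlaschkeSequence.tsum_blaschkeWeight_le (hZ : IsBlaschkeSequence Z) {γ C : ℝ}
    (hγ1 : γ ≤ 1) (hC : 0 < C)
    (h : ∀ δ > 0, ∀ φ, carlesonMass Z φ (1 - 2 * δ) ≤ C * δ ^ γ) {r : ℝ} (hr : 0 ≤ r)
    (hr1 : r < 1) (θ : ℝ) :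
    ∑' k, ENNReal.ofReal (blaschkeWeight (Z k) ((r : ℂ) * Complex.exp ((θ : ℂ) * Complex.I))) ≤
      ENNReal.ofReal (32 * C * (1 - r) ^ (γ - 1)) := by
  set z := (r : ℂ) * Complex.exp ((θ : ℂ) * Complex.I) with hz
  have hzr : ‖z‖ = r := norm_circle hr θ
  set δ := 1 - r with hδ
  have hδ0 : 0 < δ := sub_pos.2 hr1
  -- If 2^n δ ≤ |1 - āz| < 2^(n+1) δ, then a lies in the square of index j = n + 1 and its weight is
  -- at most 4(1 - |a|)/(4^n δ) = c j (1 - |a|).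
  set c : ℕ → ℝ := fun j => 16 * (1 / 4) ^ j / δ with hc
  set I : ℕ → ℕ → ℝ := fun j k =>
    (carlesonSquare θ (2 ^ j * δ)).indicator (fun w => 1 - ‖w‖) (Z k) with hI
  have key : ∀ k, ENNReal.ofReal (blaschkeWeight (Z k) z) ≤
      ∑' j, ENNReal.ofReal (c j * I j k) := by
    intro k
    have ha := hZ.norm_lt_one k
    set D := ‖1 - conj (Z k) * z‖ with hD
    have hDδ : δ ≤ D := by
      rw [hδ, ← hzr]
      exact one_sub_norm_le_norm_one_sub_conj_mul ha.le
    have hD0 : 0 < D := hδ0.trans_le hDδ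
    obtain ⟨n, hn1, hn2⟩ := exists_nat_pow_near ((one_le_div hδ0).2 hDδ) one_lt_two
    rw [le_div_iff₀ hδ0] at hn1
    rw [div_lt_iff₀ hδ0] at hn2
    have hmem := mem_carlesonSquare_of_norm_one_sub_lt ha hr hr1.le hn2
    refine le_trans (ENNReal.ofReal_le_ofReal ?_) (ENNReal.le_tsum (n + 1))
    have hIk : I (n + 1) k = 1 - ‖Z k‖ := Set.indicator_of_mem hmem _
    rw [hIk, hc, blaschkeWeight, hzr, ← hD]
    have e1 : 1 - r ^ 2 ≤ 2 * δ := by rw [hδ]; nlinarith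
    have e2 : 1 - ‖Z k‖ ^ 2 ≤ 2 * (1 - ‖Z k‖) := by nlinarith [norm_nonneg (Z k)]
    have e3 : (1 - r ^ 2) * (1 - ‖Z k‖ ^ 2) ≤ 2 * δ * (2 * (1 - ‖Z k‖)) :=
      mul_le_mul e1 e2 (by nlinarith [norm_nonneg (Z k)]) (by positivity)
    have e4 : (2 ^ n * δ) ^ 2 ≤ D ^ 2 := by gcongr
    have e5 : 0 ≤ 1 - ‖Z k‖ := by linarith
    calc _ ≤ 2 * δ * (2 * (1 - ‖Z k‖)) / (2 ^ n * δ) ^ 2 := by gcongr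
      _ = _ := by
        have : (4 : ℝ) ^ n = 2 ^ n * 2 ^ n := by rw [← mul_pow]; norm_num
        simp only [one_div, inv_pow, pow_succ (4 : ℝ), this]
        field_simp
        ring
  calc _ ≤ ∑' k, ∑' j, ENNReal.ofReal (c j * I j k) := ENNReal.tsum_le_tsum key
    _ = ∑' j, ∑' k, ENNReal.ofReal (c j * I j k) := ENNReal.tsum_comm
    _ ≤ ∑' j, ENNReal.ofReal (16 * C * δ ^ (γ - 1) * (1 / 2) ^ j) := by
      refine ENNReal.tsum_le_tsum fun j => ?_
      have hcj : 0 ≤ c j := by positivity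
      rw [← ENNReal.ofReal_tsum_of_nonneg
        (fun k => mul_nonneg hcj (hZ.indicator_nonneg _ k)) ((hZ.summable_indicator _).mul_left _),
        tsum_mul_left, ← carlesonMass_one_sub_two_mul]
      refine ENNReal.ofReal_le_ofReal ((mul_le_mul_of_nonneg_left
        (h _ (by positivity) θ) hcj).trans ?_)
      -- Since γ ≤ 1, the mass grows at most like 2^j, which leaves a factor 2^(-j) against the
      -- 4^(-j) in c j.
      have e1 : ((2 : ℝ) ^ j * δ) ^ γ ≤ 2 ^ j * δ ^ γ := by
        rw [Real.mul_rpow (by positivity) hδ0.le]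
        gcongr
        exact Real.rpow_le_self_of_one_le (one_le_pow₀ one_le_two) hγ1
      have e2 : δ ^ γ = δ ^ (γ - 1) * δ := by
        rw [Real.rpow_sub_one hδ0.ne', div_mul_cancel₀ _ hδ0.ne']
      calc _ ≤ c j * (C * (2 ^ j * δ ^ γ)) := by gcongr
        _ = _ := by
          have : (4 : ℝ) ^ j = 2 ^ j * 2 ^ j := by rw [← mul_pow]; norm_num
          rw [e2, hc]
          simp only [one_div, inv_pow, this]
          field_simp
    _ = _ := by
      rw [← ENNReal.ofReal_tsum_of_nonneg (fun j => by positivity)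
        (summable_geometric_two.mul_left _), tsum_mul_left, tsum_geometric_two]
      congr 1
      ring

end CarlesonMass

/-! ### Circle integral of a weight times |b_a|^(-1/2). -/

section Integral

/-- The kernel has the primitive 2√(t/(η+t)), which rises from 0 to 2; the bound is therefore
independent of η. -/
theorem lintegral_kernel_le {η : ℝ} (hη : 0 < η) :
    ∫⁻ t in Set.Ioi (0 : ℝ), ENNReal.ofReal (η / √(t * (η + t) ^ 3)) ≤ ENNReal.ofReal 2 := by
  set g : ℝ → ℝ := fun t => 2 * √(t / (η + t)) with hg
  set g' : ℝ → ℝ := fun t => η / √(t * (η + t) ^ 3) with hg'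
  have hc : ContinuousWithinAt g (Set.Ici 0) 0 := by
    refine ContinuousAt.continuousWithinAt ?_
    have : ContinuousAt (fun t : ℝ => t / (η + t)) 0 :=
      continuousAt_id.div (by fun_prop) (by simpa using hη.ne')
    exact (this.sqrt).const_mul 2
  have hd : ∀ t ∈ Set.Ioi (0 : ℝ), HasDerivAt g (g' t) t := by
    intro t ht
    have ht : 0 < t := ht
    have hs : 0 < η + t := by positivity
    have h1 : HasDerivAt (fun t : ℝ => t / (η + t)) ((1 * (η + t) - t * 1) / (η + t) ^ 2) t :=
      (hasDerivAt_id t).div ((hasDerivAt_id t).const_add η) hs.ne'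
    have h2 := (h1.sqrt (by positivity)).const_mul 2
    refine h2.congr_deriv ?_
    have e : √(t * (η + t) ^ 3) = √(t / (η + t)) * (η + t) ^ 2 := by
      rw [← Real.sqrt_sq (by positivity : 0 ≤ (η + t) ^ 2), ← Real.sqrt_mul (by positivity)]
      congr 1
      field_simp
    have hq : 0 < √(t / (η + t)) := Real.sqrt_pos.2 (by positivity)
    change _ = η / √(t * (η + t) ^ 3)
    rw [e]
    field_simp
    ring
  have hp : ∀ t ∈ Set.Ioi (0 : ℝ), 0 ≤ g' t := fun t _ => by positivity
  have hl : Tendsto g atTop (𝓝 2) := by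
    have h1 : Tendsto (fun t : ℝ => t / (η + t)) atTop (𝓝 1) := by
      have h2 : Tendsto (fun t : ℝ => 1 - η / (η + t)) atTop (𝓝 (1 - 0)) :=
        tendsto_const_nhds.sub ((tendsto_const_nhds (x := η)).div_atTop
          (tendsto_atTop_add_const_left _ _ tendsto_id))
      rw [sub_zero] at h2
      refine h2.congr' ?_
      filter_upwards [eventually_gt_atTop 0] with t ht
      have : η + t ≠ 0 := by positivity
      field_simp
      ring
    have h3 := (h1.sqrt).const_mul 2
    simpa using h3
  have hi := integrableOn_Ioi_deriv_of_nonneg hc hd hp hl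
  rw [← ofReal_integral_eq_lintegral_ofReal hi
    ((ae_restrict_mem measurableSet_Ioi).mono fun t ht => hp t ht),
    integral_Ioi_of_hasDerivAt_of_nonneg hc hd hp hl]
  simp [hg]

theorem lintegral_kernel_abs_le {η : ℝ} (hη : 0 < η) (α : ℝ) :
    ∫⁻ θ, ENNReal.ofReal (η / √(|θ - α| * (η + |θ - α|) ^ 3)) ≤ ENNReal.ofReal 4 := by
  set h : ℝ → ℝ≥0∞ := fun t => ENNReal.ofReal (η / √(t * (η + t) ^ 3)) with hh
  have hm : Measurable h := by fun_prop
  have h0 : h 0 = 0 := by simp [hh]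
  set f := (Set.Ioi (0 : ℝ)).indicator h with hf
  have hfm : Measurable f := hm.indicator measurableSet_Ioi
  have e : ∀ x : ℝ, h |x| = f x + f (-x) := by
    intro x
    rcases lt_trichotomy x 0 with hx | hx | hx
    · simp [hf, abs_of_neg hx, hx, hx.le]
    · simp [hf, hx, h0]
    · simp [hf, abs_of_pos hx, hx, hx.le]
  calc ∫⁻ θ, h |θ - α| = ∫⁻ θ, h |θ| := lintegral_sub_right_eq_self (fun x => h |x|) α
    _ = ∫⁻ x, f x + f (-x) := lintegral_congr e
    _ = (∫⁻ x, f x) + ∫⁻ x, f (-x) := lintegral_add_left hfm _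
    _ = (∫⁻ x, f x) + ∫⁻ x, f x := by rw [lintegral_neg_eq_self]
    _ ≤ ENNReal.ofReal 2 + ENNReal.ofReal 2 := by
      rw [hf, lintegral_indicator measurableSet_Ioi]
      exact add_le_add (lintegral_kernel_le hη) (lintegral_kernel_le hη)
    _ = ENNReal.ofReal 4 := by
      rw [← ENNReal.ofReal_add two_pos.le two_pos.le]; norm_num

/-- With D = |1 - āz| and m = |a - z|, the left side is (1-r²)(1-ρ²)/√(m D³). Averaging the two
lower bounds for D gives D ≥ (π(1-r) + |θ-α|)/(2π), and r ≥ 1/2 gives m ≥ |θ-α|/(2π). This produces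
the kernel with η = π(1-r). -/
theorem blaschkeWeight_mul_rpow_le {ρ r α θ : ℝ} (hρ : 0 ≤ ρ) (hρ1 : ρ < 1) (hr : 1 / 2 ≤ r)
    (hr1 : r < 1) (h1 : |θ - α| ≤ Real.pi) (h0 : θ ≠ α) {a z : ℂ}
    (ha : a = (ρ : ℂ) * Complex.exp ((α : ℂ) * Complex.I))
    (hz : z = (r : ℂ) * Complex.exp ((θ : ℂ) * Complex.I)) :
    blaschkeWeight a z * ‖blaschkeFactor a z‖ ^ (-(1 / 2) : ℝ) ≤
      16 * Real.pi * (1 - ρ) * (Real.pi * (1 - r) /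
        √(|θ - α| * (Real.pi * (1 - r) + |θ - α|) ^ 3)) := by
  have hπ := Real.pi_pos
  have hr0 : 0 ≤ r := by linarith
  have hna : ‖a‖ = ρ := by rw [ha, norm_circle hρ]
  have hnz : ‖z‖ = r := by rw [hz, norm_circle hr0]
  set t := |θ - α| with ht
  have ht0 : 0 < t := abs_pos.2 (sub_ne_zero.2 h0)
  set δ := 1 - r with hδ
  have hδ0 : 0 < δ := sub_pos.2 hr1
  set D := ‖1 - conj a * z‖ with hD
  set m := ‖a - z‖ with hm
  have hD1 : δ ≤ D := by
    rw [hδ, ← hnz]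
    exact one_sub_norm_le_norm_one_sub_conj_mul (hna.trans_lt hρ1).le
  have hD2 : t / Real.pi ≤ D := by
    rw [hD, ha, hz, conj_polar_mul_polar]
    exact abs_div_pi_le_norm_one_sub (mul_nonneg hρ hr0) h1
  have hD3 : (Real.pi * δ + t) / (2 * Real.pi) ≤ D := by
    have : (Real.pi * δ + t) / (2 * Real.pi) = (δ + t / Real.pi) / 2 := by field_simp
    rw [this]
    linarith
  have hm1 : t / (2 * Real.pi) ≤ m := by
    have e : a - z = Complex.exp ((α : ℂ) * Complex.I) *
        ((ρ : ℂ) - r * Complex.exp (((θ - α : ℝ) : ℂ) * Complex.I)) := by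
      have : Complex.exp ((θ : ℂ) * Complex.I) = Complex.exp ((α : ℂ) * Complex.I) *
          Complex.exp (((θ - α : ℝ) : ℂ) * Complex.I) := by
        rw [← Complex.exp_add]
        congr 1
        push_cast
        ring
      rw [ha, hz, this]
      ring
    have h2 := mul_abs_le_norm_sub hr0 hρ h1
    rw [hm, e, norm_mul, Complex.norm_exp_ofReal_mul_I, one_mul]
    refine le_trans ?_ h2
    rw [← div_div, div_right_comm, div_eq_mul_inv (t / Real.pi), mul_comm]
    have : 0 ≤ t / Real.pi := by positivity
    gcongr
    linarith
  have hD0 : 0 < D := hδ0.trans_le hD1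
  have hm0 : 0 < m := lt_of_lt_of_le (by positivity) hm1
  have e1 : 1 - r ^ 2 ≤ 2 * δ := by rw [hδ]; nlinarith
  have e2 : 1 - ρ ^ 2 ≤ 2 * (1 - ρ) := by nlinarith
  have e3 : (1 - r ^ 2) * (1 - ρ ^ 2) ≤ 2 * δ * (2 * (1 - ρ)) :=
    mul_le_mul e1 e2 (by nlinarith) (by positivity)
  have hX : 0 ≤ 1 - ρ := by linarith
  have e4 : D ^ 2 * √(m / D) = √(m * D ^ 3) := by
    rw [← Real.sqrt_sq (by positivity : 0 ≤ D ^ 2), ← Real.sqrt_mul (by positivity)]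
    congr 1
    field_simp
  have e5 : √(t * (Real.pi * δ + t) ^ 3) / (2 * Real.pi) ^ 2 ≤ √(m * D ^ 3) := by
    rw [← Real.sqrt_sq (by positivity : 0 ≤ (2 * Real.pi) ^ 2), ← Real.sqrt_div (by positivity)]
    refine Real.sqrt_le_sqrt ?_
    calc _ = t / (2 * Real.pi) * ((Real.pi * δ + t) / (2 * Real.pi)) ^ 3 := by
          field_simp
      _ ≤ _ := by gcongr
  have e6 : 0 < √(t * (Real.pi * δ + t) ^ 3) := Real.sqrt_pos.2 (by positivity)
  rw [norm_blaschkeFactor, blaschkeWeight, ← hm, ← hD, hna, hnz, Real.rpow_neg (by positivity),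
    ← Real.sqrt_eq_rpow, div_mul_eq_mul_div, ← div_eq_mul_inv, div_div, mul_comm √(m / D), e4]
  calc _ ≤ 2 * δ * (2 * (1 - ρ)) / (√(t * (Real.pi * δ + t) ^ 3) / (2 * Real.pi) ^ 2) := by
        gcongr
    _ = _ := by field_simp; ring

theorem lintegral_blaschkeWeight_mul_rpow_le {a : ℂ} (ha : ‖a‖ < 1) {r : ℝ} (hr : 1 / 2 ≤ r)
    (hr1 : r < 1) :
    ∫⁻ θ in Set.Ioc (0 : ℝ) (2 * Real.pi), ENNReal.ofReal
        (blaschkeWeight a ((r : ℂ) * Complex.exp ((θ : ℂ) * Complex.I)) *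
          ‖blaschkeFactor a ((r : ℂ) * Complex.exp ((θ : ℂ) * Complex.I))‖ ^ (-(1 / 2) : ℝ)) ≤
      ENNReal.ofReal (64 * Real.pi * (1 - ‖a‖)) := by
  obtain ⟨α, e, -, -⟩ := exists_polar_near a 0
  have hX : 0 ≤ 1 - ‖a‖ := by linarith
  have hπ := Real.pi_pos
  rw [setLIntegral_Ioc_of_periodic
    (F := fun θ => ENNReal.ofReal
        (blaschkeWeight a ((r : ℂ) * Complex.exp ((θ : ℂ) * Complex.I)) *
          ‖blaschkeFactor a ((r : ℂ) * Complex.exp ((θ : ℂ) * Complex.I))‖ ^ (-(1 / 2) : ℝ)))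
    ((periodic_circle r).comp fun z => ENNReal.ofReal
      (blaschkeWeight a z * ‖blaschkeFactor a z‖ ^ (-(1 / 2) : ℝ))) α]
  calc _ ≤ ∫⁻ θ in Set.Ioc (α - Real.pi) (α + Real.pi), ENNReal.ofReal (16 * Real.pi * (1 - ‖a‖)) *
          ENNReal.ofReal (Real.pi * (1 - r) /
            √(|θ - α| * (Real.pi * (1 - r) + |θ - α|) ^ 3)) := by
        refine lintegral_mono_ae ?_
        have hne : ∀ᵐ θ : ℝ, θ ≠ α := Measure.ae_ne volume α
        filter_upwards [ae_restrict_of_ae hne, ae_restrict_mem measurableSet_Ioc] with θ h1 h2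
        rw [← ENNReal.ofReal_mul (by positivity)]
        exact ENNReal.ofReal_le_ofReal (blaschkeWeight_mul_rpow_le (norm_nonneg a) ha hr hr1
          (abs_le.2 ⟨by linarith [h2.1], by linarith [h2.2]⟩) h1 e rfl)
    _ ≤ ∫⁻ θ, ENNReal.ofReal (16 * Real.pi * (1 - ‖a‖)) *
          ENNReal.ofReal (Real.pi * (1 - r) /
            √(|θ - α| * (Real.pi * (1 - r) + |θ - α|) ^ 3)) := setLIntegral_le_lintegral _ _
    _ ≤ ENNReal.ofReal (16 * Real.pi * (1 - ‖a‖)) * ENNReal.ofReal 4 := by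
      rw [lintegral_const_mul' _ _ ENNReal.ofReal_ne_top]
      gcongr
      exact lintegral_kernel_abs_le (mul_pos hπ (sub_pos.2 hr1)) α
    _ = _ := by
      rw [← ENNReal.ofReal_mul (by positivity)]
      congr 1
      ring

end Integral

/-! ### Upper bound for the means. -/

section UpperBound

variable {Z : ℕ → ℂ}

/-- Hölder's inequality for the weights w on finite sums, then the supremum over finite sets. It
separates the total weight, bounded pointwise, from a sum that is integrated term by term. -/
theorem ENNReal.tsum_mul_rpow_le {ι : Type*} {p : ℝ} (hp : 1 ≤ p) (w f : ι → ℝ≥0∞) :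
    (∑' i, w i * f i) ^ p ≤ (∑' i, w i) ^ (p - 1) * ∑' i, w i * f i ^ p := by
  have hp0 : 0 < p := by linarith
  have h1 : ∑' i, w i * f i ≤ (∑' i, w i) ^ (1 - p⁻¹) * (∑' i, w i * f i ^ p) ^ p⁻¹ := by
    rw [ENNReal.tsum_eq_iSup_sum]
    refine iSup_le fun s => (ENNReal.inner_le_weight_mul_Lp_of_nonneg s hp w f).trans ?_
    have : 0 ≤ 1 - p⁻¹ := sub_nonneg.2 (inv_le_one_of_one_le₀ hp)
    gcongr <;> exact ENNReal.sum_le_tsum s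
  calc _ ≤ ((∑' i, w i) ^ (1 - p⁻¹) * (∑' i, w i * f i ^ p) ^ p⁻¹) ^ p := by gcongr
    _ = _ := by
      rw [ENNReal.mul_rpow_of_nonneg _ _ hp0.le, ← ENNReal.rpow_mul, ← ENNReal.rpow_mul,
        inv_mul_cancel₀ hp0.ne', ENNReal.rpow_one, sub_mul, one_mul, inv_mul_cancel₀ hp0.ne']

theorem IsBlaschkeSequence.ofReal_abs_log_rpow_le (hZ : IsBlaschkeSequence Z) {p : ℝ} (hp : 1 ≤ p)
    {z : ℂ} (hz : ‖z‖ < 1) (h : ∀ n, z ≠ Z n) :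
    ENNReal.ofReal |Real.log ‖blaschkeProduct Z z‖| ^ p ≤
      ENNReal.ofReal (2 * p) ^ p *
        ((∑' k, ENNReal.ofReal (blaschkeWeight (Z k) z)) ^ (p - 1) *
          ∑' k, ENNReal.ofReal (blaschkeWeight (Z k) z *
            ‖blaschkeFactor (Z k) z‖ ^ (-(1 / 2) : ℝ))) := by
  have hp0 : 0 < p := by linarith
  have hs := hZ.hasSum_neg_log hz h
  have hb : ∀ k, 0 < ‖blaschkeFactor (Z k) z‖ := fun k =>
    norm_pos_iff.2 (blaschkeFactor_ne_zero (hZ.norm_lt_one k) hz (h k))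
  have hw : ∀ k, 0 < blaschkeWeight (Z k) z := fun k => blaschkeWeight_pos (hZ.norm_lt_one k) hz
  have h1 : ENNReal.ofReal |Real.log ‖blaschkeProduct Z z‖| ≤ ENNReal.ofReal (2 * p) *
      ∑' k, ENNReal.ofReal (blaschkeWeight (Z k) z) *
        ENNReal.ofReal (‖blaschkeFactor (Z k) z‖ ^ (-(1 / (2 * p)))) := by
    rw [← hs.tsum_eq, ENNReal.ofReal_tsum_of_nonneg _ hs.summable, ← ENNReal.tsum_mul_left]
    · refine ENNReal.tsum_le_tsum fun k => ?_
      rw [← ENNReal.ofReal_mul (hw k).le, ← ENNReal.ofReal_mul (by positivity)]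
      exact ENNReal.ofReal_le_ofReal (neg_log_le_blaschkeWeight (hZ.norm_lt_one k) hz (h k) hp)
    · exact fun k => neg_nonneg.2 (Real.log_nonpos (norm_nonneg _)
        (norm_blaschkeFactor_lt_one (hZ.norm_lt_one k) hz).le)
  refine (ENNReal.rpow_le_rpow h1 hp0.le).trans ?_
  rw [ENNReal.mul_rpow_of_nonneg _ _ hp0.le]
  gcongr
  refine (ENNReal.tsum_mul_rpow_le hp _ _).trans (le_of_eq ?_)
  congr 2
  ext k
  rw [ENNReal.ofReal_rpow_of_pos (Real.rpow_pos_of_pos (hb k) _), ← Real.rpow_mul (hb k).le,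
    ← ENNReal.ofReal_mul (hw k).le]
  congr 3
  field_simp

theorem measurable_blaschkeFactor (a : ℂ) : Measurable (blaschkeFactor a) := by
  unfold blaschkeFactor
  split_ifs
  · exact measurable_id
  · fun_prop

theorem measurable_blaschkeWeight (a : ℂ) : Measurable (blaschkeWeight a) := by
  unfold blaschkeWeight
  fun_prop

/-- If the Carleson masses are `O((1 - r) ^ γ)` then the means of `log |B|` are
`O((1 - r) ^ ((γ - 1) (1 - 1 / p)))`. -/
theorem IsBlaschkeSequence.exists_logMean_le (hZ : IsBlaschkeSequence Z) {γ : ℝ}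
    (hγ1 : γ ≤ 1) {C : ℝ} (hC : 0 < C)
    (h : ∀ δ > 0, ∀ φ, carlesonMass Z φ (1 - 2 * δ) ≤ C * δ ^ γ) {p : ℝ} (hp : 1 ≤ p) :
    ∃ K, ∀ r, 1 / 2 ≤ r → r < 1 →
      logMean p (blaschkeProduct Z) r ≤
        ENNReal.ofReal (K * (1 - r) ^ ((γ - 1) * (1 - 1 / p))) := by
  have hp0 : 0 < p := by linarith
  set T := ∑' k, (1 - ‖Z k‖) with hT
  have hT0 : 0 < T := hZ.summable.tsum_pos (fun k => sub_nonneg.2 (hZ.norm_lt_one k).le) 0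
    (sub_pos.2 (hZ.norm_lt_one 0))
  have hπ := Real.pi_pos
  set K₀ := (2 * Real.pi)⁻¹ * ((2 * p) ^ p * ((32 * C) ^ (p - 1) * (64 * Real.pi * T))) with hK₀
  have hK0 : 0 < K₀ := by positivity
  refine ⟨K₀ ^ (1 / p), fun r hr hr1 => ?_⟩
  have hr0 : 0 < r := by linarith
  have hδ : 0 < 1 - r := by linarith
  set A := 32 * C * (1 - r) ^ (γ - 1) with hA
  have hA0 : 0 < A := by positivity
  have hmeas : Measurable fun θ : ℝ => (r : ℂ) * Complex.exp ((θ : ℂ) * Complex.I) := by fun_prop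
  have key : ∫⁻ θ in Set.Ioc (0 : ℝ) (2 * Real.pi), ENNReal.ofReal
      |Real.log ‖blaschkeProduct Z ((r : ℂ) * Complex.exp ((θ : ℂ) * Complex.I))‖| ^ p ≤
      ENNReal.ofReal ((2 * p) ^ p * (A ^ (p - 1) * (64 * Real.pi * T))) := by
    calc _ ≤ ∫⁻ θ in Set.Ioc (0 : ℝ) (2 * Real.pi), ENNReal.ofReal ((2 * p) ^ p * A ^ (p - 1)) *
            ∑' k, ENNReal.ofReal
              (blaschkeWeight (Z k) ((r : ℂ) * Complex.exp ((θ : ℂ) * Complex.I)) *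
              ‖blaschkeFactor (Z k) ((r : ℂ) * Complex.exp ((θ : ℂ) * Complex.I))‖ ^
                (-(1 / 2) : ℝ)) := by
          refine lintegral_mono_ae (ae_restrict_of_ae ?_)
          -- The series for log|B| is used only off the zeros, which occur for countably many θ.
          filter_upwards [ae_circle_ne hr0.ne' Z] with θ hθ
          refine (hZ.ofReal_abs_log_rpow_le hp (by rwa [norm_circle hr0.le]) hθ).trans ?_
          rw [ENNReal.ofReal_mul (p := (2 * p) ^ p) (by positivity), mul_assoc,
            ← ENNReal.ofReal_rpow_of_pos (by positivity), ← ENNReal.ofReal_rpow_of_pos hA0]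
          have hp1 : 0 ≤ p - 1 := by linarith
          gcongr
          exact hZ.tsum_blaschkeWeight_le hγ1 hC h hr0.le hr1 θ
      _ = ENNReal.ofReal ((2 * p) ^ p * A ^ (p - 1)) *
            ∑' k, ∫⁻ θ in Set.Ioc (0 : ℝ) (2 * Real.pi), ENNReal.ofReal
              (blaschkeWeight (Z k) ((r : ℂ) * Complex.exp ((θ : ℂ) * Complex.I)) *
              ‖blaschkeFactor (Z k) ((r : ℂ) * Complex.exp ((θ : ℂ) * Complex.I))‖ ^
                (-(1 / 2) : ℝ)) := by
          rw [lintegral_const_mul' _ _ ENNReal.ofReal_ne_top, lintegral_tsum]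
          intro k
          have h1 := (measurable_blaschkeWeight (Z k)).comp hmeas
          have h2 := (measurable_blaschkeFactor (Z k)).comp hmeas
          exact (h1.mul (h2.norm.pow_const _)).ennreal_ofReal.aemeasurable
      _ ≤ ENNReal.ofReal ((2 * p) ^ p * A ^ (p - 1)) *
            ∑' k, ENNReal.ofReal (64 * Real.pi * (1 - ‖Z k‖)) := by
          gcongr with k
          exact lintegral_blaschkeWeight_mul_rpow_le (hZ.norm_lt_one k) hr hr1
      _ = _ := by
          rw [← ENNReal.ofReal_tsum_of_nonneg (fun k => mul_nonneg (by positivity)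
            (sub_nonneg.2 (hZ.norm_lt_one k).le)) (hZ.summable.mul_left _), tsum_mul_left,
            ← ENNReal.ofReal_mul (by positivity), mul_assoc]
  rw [logMean]
  calc _ ≤ ((ENNReal.ofReal (2 * Real.pi))⁻¹ *
        ENNReal.ofReal ((2 * p) ^ p * (A ^ (p - 1) * (64 * Real.pi * T)))) ^ (1 / p) := by gcongr
    _ = _ := by
      rw [← ENNReal.ofReal_inv_of_pos (by positivity), ← ENNReal.ofReal_mul (by positivity),
        ENNReal.ofReal_rpow_of_pos (by positivity), hA,
        Real.mul_rpow (x := 32 * C) (by positivity) (by positivity), ← Real.rpow_mul hδ.le]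
      congr 1
      have e : (2 * Real.pi)⁻¹ * ((2 * p) ^ p * ((32 * C) ^ (p - 1) *
          (1 - r) ^ ((γ - 1) * (p - 1)) * (64 * Real.pi * T))) =
          K₀ * (1 - r) ^ ((γ - 1) * (p - 1)) := by rw [hK₀]; ring
      rw [e, Real.mul_rpow hK0.le (by positivity), ← Real.rpow_mul hδ.le]
      congr 2
      field_simp

end UpperBound

/-! ### Translation between orders and power bounds. -/

section Order

theorem log_div_neg_log_le_iff {m : ℝ≥0∞} {r σ : ℝ} (hr0 : 0 < r) (hr1 : r < 1) :
    ENNReal.log m / ((-Real.log (1 - r) : ℝ) : EReal) ≤ (σ : EReal) ↔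
      m ≤ ENNReal.ofReal ((1 - r) ^ (-σ)) := by
  have hδ : 0 < 1 - r := by linarith
  have hL : 0 < -Real.log (1 - r) := neg_pos.2 (Real.log_neg hδ (by linarith))
  rw [EReal.div_le_iff_le_mul (by exact_mod_cast hL) (EReal.coe_ne_top _), ← ENNReal.log_le_log_iff,
    ENNReal.log_ofReal_of_pos (Real.rpow_pos_of_pos hδ _), Real.log_rpow hδ, ← EReal.coe_mul,
    neg_mul_comm, neg_mul, mul_comm, ← neg_mul]

theorem eventually_nhdsLT_one_mem_Ioo {l : ℝ} (hl : l < 1) : ∀ᶠ r : ℝ in 𝓝[<] 1, l < r ∧ r < 1 :=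
  Ioo_mem_nhdsLT hl

theorem rhoOrder_le_of_logMean_le {p : ℝ} {f : ℂ → ℂ} {K τ : ℝ}
    (h : ∀ r, 1 / 2 ≤ r → r < 1 → logMean p f r ≤ ENNReal.ofReal (K * (1 - r) ^ (-τ))) :
    rhoOrder p f ≤ (τ : EReal) := by
  refine EReal.le_of_forall_lt_iff_le.1 fun σ hσ => ?_
  have hσ : τ < σ := by exact_mod_cast hσ
  -- The constant K is absorbed by passing from τ to any larger σ.
  have hlim : Tendsto (fun r : ℝ => K * (1 - r) ^ (σ - τ)) (𝓝[<] 1) (𝓝 0) := by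
    have h1 : ContinuousAt (fun r : ℝ => K * (1 - r) ^ (σ - τ)) 1 := by
      refine ContinuousAt.mul continuousAt_const (ContinuousAt.rpow_const (by fun_prop) ?_)
      exact Or.inr (by linarith)
    have h2 := h1.tendsto
    rw [sub_self, Real.zero_rpow (by linarith), mul_zero] at h2
    exact h2.mono_left nhdsWithin_le_nhds
  refine limsup_le_of_le (by isBoundedDefault) ?_
  filter_upwards [hlim.eventually (gt_mem_nhds one_pos),
    eventually_nhdsLT_one_mem_Ioo (l := 1 / 2) (by norm_num)] with r h1 h2
  have hδ : 0 < 1 - r := by linarith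
  rw [log_div_neg_log_le_iff (by linarith) h2.2]
  refine (h r h2.1.le h2.2).trans (ENNReal.ofReal_le_ofReal ?_)
  have e : (1 - r) ^ (-τ) = (1 - r) ^ (σ - τ) * (1 - r) ^ (-σ) := by
    rw [← Real.rpow_add hδ]
    congr 1
    ring
  rw [e, ← mul_assoc]
  exact mul_le_of_le_one_left (by positivity) h1.le

theorem eventually_logMean_le_of_rhoOrder_lt {p : ℝ} {f : ℂ → ℂ} {σ : ℝ}
    (h : rhoOrder p f < (σ : EReal)) :
    ∀ᶠ r : ℝ in 𝓝[<] 1, logMean p f r ≤ ENNReal.ofReal ((1 - r) ^ (-σ)) := by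
  filter_upwards [eventually_lt_of_limsup_lt h (by isBoundedDefault),
    eventually_nhdsLT_one_mem_Ioo (l := 0) one_pos] with r h1 h2
  exact (log_div_neg_log_le_iff h2.1 h2.2).1 h1.le

end Order

/-! ### Lower bound for the means. -/

section LowerBound

variable {Z : ℕ → ℂ}

theorem norm_one_sub_conj_mul_le {a : ℂ} {φ r θ : ℝ} (hr : 0 ≤ r) (hr1 : r ≤ 1)
    (ha : a ∈ carlesonSquare φ ((1 - r) / 2)) (hθ : |θ - φ| ≤ (1 - r) / 2) :
    ‖1 - conj a * ((r : ℂ) * Complex.exp ((θ : ℂ) * Complex.I))‖ ≤ 4 * (1 - r) := by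
  obtain ⟨ρ, α, h1, h2, h3, h4, h5, rfl⟩ := ha
  rw [conj_polar_mul_polar]
  have hα : |α - φ| ≤ Real.pi * ((1 - r) / 2) := abs_le.2 ⟨h4.le, h5⟩
  have h6 : |θ - α| ≤ (1 - r) / 2 + Real.pi * ((1 - r) / 2) := by
    have : |θ - α| ≤ |θ - φ| + |φ - α| := abs_sub_le _ _ _
    rw [abs_sub_comm φ α] at this
    linarith
  have h7 := Real.norm_exp_I_mul_ofReal_sub_one_le (x := θ - α)
  rw [Real.norm_eq_abs, mul_comm] at h7
  set e := Complex.exp (((θ - α : ℝ) : ℂ) * Complex.I) with he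
  have hs0 : 0 ≤ ρ * r := mul_nonneg h1 hr
  have hs1 : ρ * r ≤ 1 := mul_le_one₀ h2 hr hr1
  have h8 : ‖1 - ((ρ * r : ℝ) : ℂ) * e‖ ≤ (1 - ρ * r) + ‖e - 1‖ := by
    have e1 : 1 - ((ρ * r : ℝ) : ℂ) * e = ((1 - ρ * r : ℝ) : ℂ) - ((ρ * r : ℝ) : ℂ) * (e - 1) := by
      push_cast; ring
    rw [e1]
    refine (norm_sub_le _ _).trans ?_
    rw [norm_mul, Complex.norm_real, Complex.norm_real, Real.norm_of_nonneg hs0,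
      Real.norm_of_nonneg (by linarith)]
    have := mul_le_of_le_one_left (norm_nonneg (e - 1)) hs1
    linarith
  -- The constant 4 is 3/2 + 1/2 + 2, in units of 1 - r: from 1 - ρr, from |θ - φ|, and from |α - φ|
  -- with π ≤ 4.
  have h9 : Real.pi * ((1 - r) / 2) ≤ 4 * ((1 - r) / 2) :=
    mul_le_mul_of_nonneg_right Real.pi_le_four (by linarith)
  nlinarith

theorem IsBlaschkeSequence.carlesonMass_div_le_abs_log (hZ : IsBlaschkeSequence Z) {φ r θ : ℝ}
    (hr : 0 ≤ r) (hr1 : r < 1) (hθ : |θ - φ| ≤ (1 - r) / 2)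
    (h : ∀ n, (r : ℂ) * Complex.exp ((θ : ℂ) * Complex.I) ≠ Z n) :
    carlesonMass Z φ r / (32 * (1 - r)) ≤
      |Real.log ‖blaschkeProduct Z ((r : ℂ) * Complex.exp ((θ : ℂ) * Complex.I))‖| := by
  have hzr := norm_circle hr θ
  set z := (r : ℂ) * Complex.exp ((θ : ℂ) * Complex.I) with hz
  have hz1 : ‖z‖ < 1 := by rwa [hzr]
  have hδ : 0 < 1 - r := by linarith
  have hs := hZ.hasSum_neg_log hz1 h
  refine hasSum_le (fun k => ?_) ((hZ.summable_indicator _).hasSum.div_const _) hs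
  have ha := hZ.norm_lt_one k
  have hw := blaschkeWeight_le_neg_log ha hz1 (h k)
  by_cases hk : Z k ∈ carlesonSquare φ ((1 - r) / 2)
  · rw [Set.indicator_of_mem hk]
    refine le_trans ?_ hw
    have hD := norm_one_sub_conj_mul_le hr hr1.le hk hθ
    have hD0 := norm_pos_iff.2 (one_sub_conj_mul_ne_zero ha hz1)
    rw [blaschkeWeight, hzr]
    have e1 : 1 - r ≤ 1 - r ^ 2 := by nlinarith
    have e2 : 1 - ‖Z k‖ ≤ 1 - ‖Z k‖ ^ 2 := by nlinarith [norm_nonneg (Z k)]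
    have e3 : 0 ≤ 1 - ‖Z k‖ := by linarith
    have e4 : 0 ≤ (1 - r ^ 2) * (1 - ‖Z k‖ ^ 2) := mul_nonneg (by linarith) (by linarith)
    have e5 : 0 ≤ 1 - r ^ 2 := by linarith
    calc _ = (1 - r) * (1 - ‖Z k‖) / (4 * (1 - r)) ^ 2 / 2 := by field_simp; ring
      _ ≤ _ := by gcongr
  · rw [Set.indicator_of_notMem hk, zero_div]
    exact le_trans (by have := blaschkeWeight_pos ha hz1; linarith) hw

theorem IsBlaschkeSequence.le_logMean (hZ : IsBlaschkeSequence Z) {p : ℝ} (hp : 1 ≤ p) {φ r : ℝ}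
    (hr : 0 < r) (hr1 : r < 1) :
    ENNReal.ofReal (((1 - r) / (2 * Real.pi)) ^ (1 / p) * (carlesonMass Z φ r / (32 * (1 - r)))) ≤
      logMean p (blaschkeProduct Z) r := by
  have hp0 : 0 < p := by linarith
  have hπ := Real.pi_pos
  have hδ : 0 < 1 - r := by linarith
  set c := carlesonMass Z φ r / (32 * (1 - r)) with hc
  have hc0 : 0 ≤ c := div_nonneg (hZ.carlesonMass_nonneg φ r) (by positivity)
  set F : ℝ → ℝ≥0∞ := fun θ => ENNReal.ofReal
      |Real.log ‖blaschkeProduct Z ((r : ℂ) * Complex.exp ((θ : ℂ) * Complex.I))‖| ^ p with hF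
  have key : ENNReal.ofReal c ^ p * ENNReal.ofReal (1 - r) ≤
      ∫⁻ θ in Set.Ioc (0 : ℝ) (2 * Real.pi), F θ := by
    have hper : Function.Periodic F (2 * Real.pi) := (periodic_circle r).comp fun z =>
      ENNReal.ofReal |Real.log ‖blaschkeProduct Z z‖| ^ p
    rw [setLIntegral_Ioc_of_periodic hper φ]
    -- Only this arc of length 1 - r is kept; it produces the factor ((1-r)/(2π))^(1/p).
    have hsub : Set.Ioc (φ - (1 - r) / 2) (φ + (1 - r) / 2) ⊆
        Set.Ioc (φ - Real.pi) (φ + Real.pi) :=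
      Set.Ioc_subset_Ioc (by linarith [Real.two_le_pi]) (by linarith [Real.two_le_pi])
    refine le_trans ?_ (lintegral_mono_set hsub)
    have hvol : ENNReal.ofReal (1 - r) =
        volume (Set.Ioc (φ - (1 - r) / 2) (φ + (1 - r) / 2)) := by
      rw [Real.volume_Ioc]
      congr 1
      ring
    rw [hvol, ← setLIntegral_const]
    refine lintegral_mono_ae ?_
    filter_upwards [ae_restrict_of_ae (ae_circle_ne hr.ne' Z), ae_restrict_mem measurableSet_Ioc]
      with θ h1 h2
    refine ENNReal.rpow_le_rpow (ENNReal.ofReal_le_ofReal ?_) hp0.le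
    exact hZ.carlesonMass_div_le_abs_log hr.le hr1
      (abs_le.2 ⟨by linarith [h2.1], by linarith [h2.2]⟩) h1
  rw [logMean]
  refine le_trans (le_of_eq ?_) (ENNReal.rpow_le_rpow (mul_le_mul_right key _) (by positivity))
  rw [← ENNReal.ofReal_inv_of_pos (by positivity), ENNReal.ofReal_rpow_of_nonneg hc0 hp0.le,
    ← ENNReal.ofReal_mul (by positivity), ← ENNReal.ofReal_mul (by positivity),
    ENNReal.ofReal_rpow_of_nonneg (by positivity) (by positivity)]
  congr 1
  have e : (2 * Real.pi)⁻¹ * (c ^ p * (1 - r)) = (1 - r) / (2 * Real.pi) * c ^ p := by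
    rw [div_eq_mul_inv]; ring
  rw [e, Real.mul_rpow (by positivity) (by positivity), ← Real.rpow_mul hc0,
    mul_one_div_cancel hp0.ne', Real.rpow_one]

theorem IsBlaschkeSequence.isBigO_carlesonMass_of_rhoOrder_lt (hZ : IsBlaschkeSequence Z) {p σ : ℝ}
    (hp : 1 ≤ p) (h : rhoOrder p (blaschkeProduct Z) < (σ : EReal)) :
    (fun r : ℝ => ⨆ φ : ℝ, carlesonMass Z φ r) =O[𝓝[<] 1]
      fun r : ℝ => (1 - r) ^ (1 - 1 / p - σ) := by
  have hπ := Real.pi_pos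
  refine IsBigO.of_bound (32 * (2 * Real.pi) ^ (1 / p)) ?_
  filter_upwards [eventually_logMean_le_of_rhoOrder_lt h,
    eventually_nhdsLT_one_mem_Ioo (l := 0) one_pos] with r h1 h2
  have hδ : 0 < 1 - r := by linarith
  rw [Real.norm_of_nonneg (hZ.iSup_carlesonMass_nonneg r), Real.norm_of_nonneg (by positivity)]
  refine ciSup_le fun φ => ?_
  have h3 := (ENNReal.ofReal_le_ofReal_iff (by positivity)).1
    ((hZ.le_logMean hp (φ := φ) h2.1 h2.2).trans h1)
  have e : (1 - r) ^ (1 - 1 / p - σ) = (1 - r) * (1 - r) ^ (-σ) / (1 - r) ^ (1 / p) := by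
    rw [show 1 - 1 / p - σ = 1 + -σ - 1 / p by ring, Real.rpow_sub hδ, Real.rpow_add hδ,
      Real.rpow_one]
  rw [Real.div_rpow hδ.le (by positivity)] at h3
  have hx : 0 < (1 - r) ^ (1 / p) := by positivity
  have hy : 0 < (2 * Real.pi) ^ (1 / p) := by positivity
  rw [e, mul_div_assoc', le_div_iff₀ hx]
  rw [div_mul_div_comm, div_le_iff₀ (by positivity)] at h3
  linarith

end LowerBound

/-! ### The set of admissible exponents. -/

section Exponent

variable {Z : ℕ → ℂ}

/-- The exponents admitted in the definition of `carlesonExponent`. -/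
def carlesonExponentSet (Z : ℕ → ℂ) : Set ℝ :=
  {γ : ℝ | 0 ≤ γ ∧
    (fun r : ℝ => ⨆ φ : ℝ, carlesonMass Z φ r) =O[𝓝[<] 1] fun r : ℝ => (1 - r) ^ γ}

theorem carlesonExponent_eq_sSup (Z : ℕ → ℂ) :
    carlesonExponent Z = sSup ((fun γ : ℝ => (γ : EReal)) '' carlesonExponentSet Z) := rfl

theorem IsBlaschkeSequence.zero_mem_carlesonExponentSet (hZ : IsBlaschkeSequence Z) :
    (0 : ℝ) ∈ carlesonExponentSet Z := by
  refine ⟨le_rfl, IsBigO.of_bound (∑' k, (1 - ‖Z k‖)) (Eventually.of_forall fun r => ?_)⟩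
  rw [Real.norm_of_nonneg (hZ.iSup_carlesonMass_nonneg r), Real.rpow_zero, norm_one, mul_one]
  exact ciSup_le fun φ => hZ.carlesonMass_le φ r

/-- The square of size 1 - |z_k| at z_k contains z_k, so 1 - |z_k| ≤ C(1 - |z_k|)^γ. For γ > 1 this
fails in the limit, since an infinite Blaschke sequence has 1 - |z_k| → 0. -/
theorem IsBlaschkeSequence.le_one_of_mem_carlesonExponentSet (hZ : IsBlaschkeSequence Z) {γ : ℝ}
    (h : γ ∈ carlesonExponentSet Z) : γ ≤ 1 := by
  obtain ⟨hγ, h⟩ := h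
  by_contra! hlt
  obtain ⟨C, hC, hb⟩ := hZ.exists_carlesonMass_le hγ h
  have h1 : ∀ k, 1 ≤ C * (1 - ‖Z k‖) ^ (γ - 1) := by
    intro k
    have hd : 0 < 1 - ‖Z k‖ := sub_pos.2 (hZ.norm_lt_one k)
    obtain ⟨α, e, -, -⟩ := exists_polar_near (Z k) 0
    have hmem : Z k ∈ carlesonSquare α (1 - ‖Z k‖) :=
      ⟨‖Z k‖, α, norm_nonneg _, (hZ.norm_lt_one k).le, by linarith,
        by rw [sub_self]; exact neg_neg_of_pos (mul_pos Real.pi_pos hd),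
        by rw [sub_self]; exact (mul_pos Real.pi_pos hd).le, e⟩
    have h2 := hb _ hd α
    rw [carlesonMass_one_sub_two_mul] at h2
    have h3 := (hZ.summable_indicator (carlesonSquare α (1 - ‖Z k‖))).le_tsum k
      fun j _ => hZ.indicator_nonneg _ j
    rw [Set.indicator_of_mem hmem] at h3
    rw [Real.rpow_sub_one hd.ne', mul_div_assoc', le_div_iff₀ hd, one_mul]
    exact h3.trans h2
  have hlim : Tendsto (fun k => C * (1 - ‖Z k‖) ^ (γ - 1)) atTop (𝓝 (C * 0 ^ (γ - 1))) :=
    (hZ.summable.tendsto_atTop_zero.rpow_const (Or.inr (by linarith))).const_mul C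
  rw [Real.zero_rpow (by linarith), mul_zero] at hlim
  exact absurd (ge_of_tendsto' hlim h1) (by norm_num)

theorem IsBlaschkeSequence.exists_isLUB_carlesonExponentSet (hZ : IsBlaschkeSequence Z) :
    ∃ t : ℝ, 0 ≤ t ∧ t ≤ 1 ∧ IsLUB (carlesonExponentSet Z) t ∧ carlesonExponent Z = (t : EReal) := by
  have hne : (carlesonExponentSet Z).Nonempty := ⟨0, hZ.zero_mem_carlesonExponentSet⟩
  have hbd : BddAbove (carlesonExponentSet Z) :=
    ⟨1, fun γ h => hZ.le_one_of_mem_carlesonExponentSet h⟩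
  have hlub := isLUB_csSup hne hbd
  refine ⟨_, hlub.1 hZ.zero_mem_carlesonExponentSet,
    hlub.2 fun γ h => hZ.le_one_of_mem_carlesonExponentSet h, hlub, ?_⟩
  rw [carlesonExponent_eq_sSup]
  refine le_antisymm (sSup_le ?_) ?_
  · rintro _ ⟨γ, h, rfl⟩
    exact EReal.coe_le_coe_iff.2 (hlub.1 h)
  · refine EReal.ge_of_forall_gt_iff_ge.1 fun s hs => ?_
    obtain ⟨γ, h, h1⟩ := exists_lt_of_lt_csSup hne (EReal.coe_lt_coe_iff.1 hs)
    exact (EReal.coe_le_coe_iff.2 h1.le).trans (le_sSup ⟨γ, h, rfl⟩)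

theorem IsBlaschkeSequence.rhoOrder_le (hZ : IsBlaschkeSequence Z) {γ : ℝ}
    (h : γ ∈ carlesonExponentSet Z) {p : ℝ} (hp : 1 ≤ p) :
    rhoOrder p (blaschkeProduct Z) ≤ ((1 - γ : ℝ) : EReal) := by
  have hγ1 := hZ.le_one_of_mem_carlesonExponentSet h
  obtain ⟨C, hC, hb⟩ := hZ.exists_carlesonMass_le h.1 h.2
  obtain ⟨K, hm⟩ := hZ.exists_logMean_le hγ1 hC hb hp
  refine (rhoOrder_le_of_logMean_le (K := K) (τ := (1 - γ) * (1 - 1 / p)) fun r hr hr1 => ?_).trans ?_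
  -- The exponent obtained is (1-γ)(1-1/p); the factor 1 - 1/p ≤ 1 is then dropped, which needs γ ≤
  -- 1.
  · convert hm r hr hr1 using 4
    ring
  · refine EReal.coe_le_coe_iff.2 (mul_le_of_le_one_right (by linarith) ?_)
    have : 0 ≤ 1 / p := by positivity
    linarith

end Exponent

/-! ### The squeeze as p → ∞. -/

theorem corollary1 (Z : ℕ → ℂ) (hZ : IsBlaschkeSequence Z) :
    Tendsto (fun p : ℝ => rhoOrder p (blaschkeProduct Z)) atTop
        (𝓝 (rhoInfOrder (blaschkeProduct Z))) ∧
      rhoInfOrder (blaschkeProduct Z) = 1 - carlesonExponent Z := by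
  obtain ⟨t, ht0, -, hlub, ht⟩ := hZ.exists_isLUB_carlesonExponentSet
  have hupper : ∀ p : ℝ, 1 ≤ p → rhoOrder p (blaschkeProduct Z) ≤ ((1 - t : ℝ) : EReal) := by
    intro p hp
    refine EReal.le_of_forall_lt_iff_le.1 fun σ hσ => ?_
    have hσ : 1 - σ < t := by linarith [EReal.coe_lt_coe_iff.1 hσ]
    obtain ⟨γ, h, h1, -⟩ := hlub.exists_between hσ
    exact (hZ.rhoOrder_le h hp).trans (EReal.coe_le_coe_iff.2 (by linarith))
  have hlower : ∀ p : ℝ, 1 ≤ p →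
      ((1 - 1 / p - t : ℝ) : EReal) ≤ rhoOrder p (blaschkeProduct Z) := by
    intro p hp
    refine EReal.le_of_forall_lt_iff_le.1 fun σ hσ => EReal.coe_le_coe_iff.2 ?_
    have hO := hZ.isBigO_carlesonMass_of_rhoOrder_lt hp hσ
    -- Only nonnegative exponents are admissible; when 1 - 1/p - σ ≤ 0, the inequality follows from
    -- t ≥ 0.
    rcases le_total 0 (1 - 1 / p - σ) with h | h
    · linarith [hlub.1 ⟨h, hO⟩]
    · linarith
  have hlim : Tendsto (fun p : ℝ => rhoOrder p (blaschkeProduct Z)) atTop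
      (𝓝 ((1 - t : ℝ) : EReal)) := by
    have h1 : Tendsto (fun p : ℝ => 1 - 1 / p - t) atTop (𝓝 (1 - 0 - t)) :=
      (tendsto_const_nhds.sub (tendsto_const_nhds.div_atTop tendsto_id)).sub_const t
    rw [sub_zero] at h1
    refine tendsto_of_tendsto_of_tendsto_of_le_of_le'
      ((continuous_coe_real_ereal.tendsto _).comp h1) tendsto_const_nhds ?_ ?_
    · filter_upwards [eventually_ge_atTop 1] with p hp using hlower p hp
    · filter_upwards [eventually_ge_atTop 1] with p hp using hupper p hp
  have he : rhoInfOrder (blaschkeProduct Z) = ((1 - t : ℝ) : EReal) := hlim.limUnder_eq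
  refine ⟨by rwa [he], ?_⟩
  rw [he, ht]
  rfl
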